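/- Let $p$ be a prime, let $k$ be a field of characteristic $p$, and let $R=k[X,Y,Z]$ with its standard grading and homogeneous maximal ideal $\mathfrak m=(X,Y,Z)$. For a homogeneous ideal $I$ of $R$ and $n\ge 0$ let $I^{[p^n]}$ be the ideal generated by all $x^{p^n}$, $x\in I$, let $H^0_{\mathfrak m}(R/I^{[p^n]})$ be the submodule of elements of $R/I^{[p^n]}$ annihilated by some power of $\mathfrak m$, and let $$e_{gHK}(R/I)=\lim_{n\to\infty}\frac{\ell_R\bigl(H^0_{\mathfrak m}(R/I^{[p^n]})\bigr)}{p^{\,n\dim R}}$$ be the generalized Hilbert–Kunz multiplicity (with value $\infty$ if the limit does not exist). A closure operation $c$ on the ideals of $R$ is a map $I\mapsto I^c$ that preserves inclusions and satisfies $I\subseteq I^c=(I^c)^c$; two ideals $I,J$ projectively have the same closure with respect to $c$ if $(I^n)^c=(J^m)^c$ for some integers $n,m\ge 1$. There is no polynomial $F$ in two variables with real coefficients such that $$F\bigl(e_{gHK}(R/I),\,e_{gHK}(R/J)\bigr)=e_{gHK}(R/IJ)$$ for all homogeneous ideals $I,J$ of $R$, even if one restricts to pairs $I,J$ that projectively have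 the same closure. More precisely, for every such $F$ there are homogeneous ideals $I,J$ of $R$ that projectively have the same closure with respect to every closure operation on ideals of $R$, such that $e_{gHK}(R/I)$, $e_{gHK}(R/J)$, $e_{gHK}(R/IJ)$ are all finite and $F\bigl(e_{gHK}(R/I),e_{gHK}(R/J)\bigr)\ne e_{gHK}(R/IJ)$. -/

import Mathlib

open Filter Topology
open scoped ENNReal NNReal

noncomputable section

/-- The section functor `H⁰_𝔪(M)`: the submodule of all elements of `M` that are annihilated by
some power of the ideal `𝔪`. -/
def sectionModule {R : Type*} [CommRing R] (𝔪 : Ideal R) (M : Type*) [AddCommGroup M] [Module R M] :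
    Submodule R M where
  carrier := {x | ∃ t : ℕ, ∀ a ∈ 𝔪 ^ t, a • x = 0}
  zero_mem' := ⟨0, fun a _ => smul_zero a⟩
  add_mem' := by
    rintro x y ⟨s, hs⟩ ⟨t, ht⟩
    refine ⟨s + t, fun a ha => ?_⟩
    rw [smul_add, hs a (Ideal.pow_le_pow_right (Nat.le_add_right s t) ha),
      ht a (Ideal.pow_le_pow_right (Nat.le_add_left t s) ha), add_zero]
  smul_mem' := by
    rintro r x ⟨t, ht⟩
    exact ⟨t, fun a ha => by rw [smul_comm, ht a ha, smul_zero]⟩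

/-- The ideal `I^{[q]}` generated by the `q`-th powers of the elements of `I`; for `q = p ^ n` in a
ring of characteristic `p` it is the `n`-th Frobenius power of `I`. -/
def frobeniusPower {R : Type*} [CommRing R] (I : Ideal R) (q : ℕ) : Ideal R :=
  Ideal.span {y | ∃ x ∈ I, y = x ^ q}

/-- The Krull dimension of `R` as a natural number (meaningful for a nonzero ring of finite
dimension). -/
def krullDimNat (R : Type*) [CommRing R] : ℕ :=
  ((ringKrullDim R).unbotD 0).toNat

section Graded

variable {k R : Type*} [Field k] [CommRing R] [Algebra k R]
  (𝒜 : ℕ → Submodule k R) [GradedAlgebra 𝒜]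

/-- The generalized Hilbert-Kunz function `n ↦ ℓ_R(H⁰_𝔪(R / I^{[p^n]}))` of `R / I`, where `𝔪` is
the irrelevant ideal of the graded ring `R`. -/
def gHKFunction (p : ℕ) (I : Ideal R) (n : ℕ) : ℕ∞ :=
  Module.length R
    (sectionModule (HomogeneousIdeal.irrelevant 𝒜).toIdeal (R ⧸ frobeniusPower I (p ^ n)))

open Classical in
/-- The generalized Hilbert-Kunz multiplicity of `R / I`: the limit of
`ℓ_R(H⁰_𝔪(R / I^{[p^n]})) / p^{n dim R}` if it exists, and `∞` otherwise. -/
def gHKMultiplicity (p : ℕ) (I : Ideal R) : ℝ≥0∞ :=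
  if h : ∃ e : ℝ≥0∞, Tendsto
      (fun n : ℕ => (gHKFunction 𝒜 p I n : ℝ≥0∞) / (p : ℝ≥0∞) ^ (n * krullDimNat R)) atTop (𝓝 e)
  then h.choose else ∞

end Graded

/-- Two ideals `I` and `J` projectively have the same closure with respect to a closure operation
`c` on ideals if `(I^n)^c = (J^m)^c` for some positive integers `n` and `m`. -/
def ProjectivelySameClosure {R : Type*} [CommRing R] (c : ClosureOperator (Ideal R))
    (I J : Ideal R) : Prop :=
  ∃ n m : ℕ, 0 < n ∧ 0 < m ∧ c (I ^ n) = c (J ^ m)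

end

/- Polynomial rings carry their standard grading by total degree. -/
attribute [local instance] MvPolynomial.gradedAlgebra

/-! Two examples demand incompatible values of `F` at `(0, 0)`. For `I = J = (XY, YZ, XZ)` every
Frobenius power is saturated, so both multiplicities vanish. But `(I ^ 2)^{[q]}` is not saturated:
its saturation needs the extra generator `(XYZ)^q`, whose colon ideal is `(X^q, Y^q, Z^q)`. The
section module thus has length `q ^ 3`, and the multiplicity of `I * J` is `1`. For `I = (X)`, `J =
(X^2)` all three multiplicities are `0`. In both cases some powers of `I` and `J` coincide, so every
closure agrees on them.

All ideals are monomial, so saturation and colons reduce to inequalities between exponents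
(`length_sectionModule_eq_zero`, `length_sectionModule_eq_length_quotient`). -/

section Length

variable {R : Type*} [CommRing R]

/-- If `x` is a nonzerodivisor modulo `J`, then `ℓ(R / (J, x^n)) = n ℓ(R / (J, x))`. -/
theorem length_quotient_sup_span_pow (J : Ideal R) (x : R) (hx : ∀ r, x * r ∈ J → r ∈ J) (n : ℕ) :
    Module.length R (R ⧸ (J ⊔ Ideal.span {x ^ n})) =
      n * Module.length R (R ⧸ (J ⊔ Ideal.span {x})) := by
  induction n with
  | zero =>
    have : Subsingleton (R ⧸ (J ⊔ Ideal.span {x ^ 0})) := by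
      rw [Ideal.Quotient.subsingleton_iff]
      simp
    rw [Module.length_eq_zero]
    simp
  | succ n ih =>
    have hle : J ⊔ Ideal.span {x ^ n} ≤
        Submodule.comap (LinearMap.mulLeft R x) (J ⊔ Ideal.span {x ^ (n + 1)}) := by
      refine sup_le (fun r hr => ?_) ?_
      · exact Ideal.mem_sup_left (J.mul_mem_left x hr)
      · rw [Ideal.span_le, Set.singleton_subset_iff]
        exact Ideal.mem_sup_right (Ideal.mem_span_singleton.2 (dvd_of_eq (pow_succ' x n)))
    have hle' : J ⊔ Ideal.span {x ^ (n + 1)} ≤ J ⊔ Ideal.span {x} :=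
      sup_le_sup_left (Ideal.span_singleton_le_span_singleton.2 (dvd_pow_self x (by simp))) J
    let f : (R ⧸ (J ⊔ Ideal.span {x ^ n})) →ₗ[R] (R ⧸ (J ⊔ Ideal.span {x ^ (n + 1)})) :=
      Submodule.mapQ _ _ (LinearMap.mulLeft R x) hle
    let g : (R ⧸ (J ⊔ Ideal.span {x ^ (n + 1)})) →ₗ[R] (R ⧸ (J ⊔ Ideal.span {x})) :=
      Submodule.factor hle'
    -- If `x * r = j + x ^ (n + 1) * s` with `j ∈ J`, cancelling `x` modulo `J` gives `r - x ^ n * s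
    -- ∈ J`.
    have hf : Function.Injective f := by
      rw [← LinearMap.ker_eq_bot, LinearMap.ker_eq_bot']
      intro y hy
      obtain ⟨r, rfl⟩ := Submodule.Quotient.mk_surjective _ y
      have hr : x * r ∈ J ⊔ Ideal.span {x ^ (n + 1)} :=
        (Submodule.Quotient.mk_eq_zero _).1 hy
      obtain ⟨j, hj, z, hz, hjz⟩ := Submodule.mem_sup.1 hr
      obtain ⟨s, rfl⟩ := Ideal.mem_span_singleton.1 hz
      have hd : r - x ^ n * s ∈ J := by
        refine hx _ ?_
        have : x * (r - x ^ n * s) = j := by rw [mul_sub, ← hjz]; ring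
        rwa [this]
      refine (Submodule.Quotient.mk_eq_zero _).2 ?_
      rw [← sub_add_cancel r (x ^ n * s)]
      exact add_mem (Ideal.mem_sup_left hd)
        (Ideal.mem_sup_right (Ideal.mem_span_singleton.2 (dvd_mul_right _ _)))
    have hg : Function.Surjective g := Submodule.factor_surjective hle'
    have hfg : Function.Exact f g := by
      intro y
      obtain ⟨r, rfl⟩ := Submodule.Quotient.mk_surjective _ y
      constructor
      · intro hy
        have hr : r ∈ J ⊔ Ideal.span {x} := (Submodule.Quotient.mk_eq_zero _).1 hy
        obtain ⟨j, hj, z, hz, rfl⟩ := Submodule.mem_sup.1 hr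
        obtain ⟨s, rfl⟩ := Ideal.mem_span_singleton.1 hz
        refine ⟨Submodule.Quotient.mk s, (Submodule.Quotient.eq _).2 ?_⟩
        have : LinearMap.mulLeft R x s - (j + x * s) = -j := by simp
        rw [this]
        exact neg_mem (Ideal.mem_sup_left hj)
      · rintro ⟨z, hz⟩
        obtain ⟨s, rfl⟩ := Submodule.Quotient.mk_surjective _ z
        rw [← hz]
        exact (Submodule.Quotient.mk_eq_zero _).2
          (Ideal.mem_sup_right (Ideal.mem_span_singleton.2 (dvd_mul_right _ _)))
    rw [Module.length_eq_add_of_exact f g hf hg hfg, ih]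
    push_cast
    ring

end Length

section Frobenius

variable {R : Type*} [CommRing R] (p : ℕ) [Fact p.Prime] [CharP R p]

theorem frobeniusPower_eq_map (I : Ideal R) (n : ℕ) :
    frobeniusPower I (p ^ n) = I.map (iterateFrobenius R p n) := by
  refine congrArg Ideal.span (Set.ext fun y => ?_)
  simp [iterateFrobenius_def, eq_comm]

/-- Since `x ↦ x ^ p ^ n` is a ring homomorphism, powers of generators suffice. -/
theorem frobeniusPower_span (S : Set R) (n : ℕ) :
    frobeniusPower (Ideal.span S) (p ^ n) = Ideal.span ((fun x => x ^ p ^ n) '' S) := by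
  rw [frobeniusPower_eq_map, Ideal.map_span]
  rfl

end Frobenius

/-! ### Monomial ideals and their section modules in terms of exponents -/

section Monomial

open MvPolynomial Pointwise

variable {σ : Type*} (k : Type*) [Field k]

/-- The ideal generated by the monomials with exponents in `S`. -/
noncomputable abbrev monomialIdeal (S : Set (σ →₀ ℕ)) : Ideal (MvPolynomial σ k) :=
  Ideal.span ((fun s => monomial s (1 : k)) '' S)

theorem monomialIdeal_mul (S T : Set (σ →₀ ℕ)) :
    monomialIdeal k S * monomialIdeal k T = monomialIdeal k (S + T) := by
  rw [monomialIdeal, monomialIdeal, Ideal.span_mul_span', monomialIdeal]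
  congr 1
  ext f
  simp [Set.mem_mul, Set.mem_add, monomial_mul]

theorem frobeniusPower_monomialIdeal (p : ℕ) [Fact p.Prime] [CharP k p] (S : Set (σ →₀ ℕ))
    (n : ℕ) : frobeniusPower (monomialIdeal k S) (p ^ n) = monomialIdeal k ((fun s => p ^ n • s) '' S) := by
  rw [monomialIdeal, frobeniusPower_span, Set.image_image, monomialIdeal,
    Set.image_image]
  simp [monomial_pow]

theorem monomialIdeal_sup (S T : Set (σ →₀ ℕ)) :
    monomialIdeal k S ⊔ monomialIdeal k T = monomialIdeal k (S ∪ T) := by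
  rw [monomialIdeal, monomialIdeal, monomialIdeal, Set.image_union, Ideal.span_union]

theorem span_singleton_X_pow (i : σ) (n : ℕ) :
    Ideal.span {(X i : MvPolynomial σ k) ^ n} = monomialIdeal k {Finsupp.single i n} := by
  simp [monomialIdeal, X_pow_eq_monomial]

variable {k}

theorem monomial_mul_mem_monomialIdeal {S : Set (σ →₀ ℕ)} {t : σ →₀ ℕ} {f : MvPolynomial σ k} :
    monomial t 1 * f ∈ monomialIdeal k S ↔ ∀ m ∈ f.support, ∃ s ∈ S, s ≤ t + m := by
  classical
  rw [mem_ideal_span_monomial_image]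
  constructor
  · intro h m hm
    exact h _ (by simpa [coeff_monomial_mul] using hm)
  · intro h m hm
    rw [mem_support_iff, coeff_monomial_mul'] at hm
    have htm : t ≤ m := by
      by_contra hn
      simp [hn] at hm
    simp only [htm, if_true, one_mul] at hm
    simpa [htm] using h _ (mem_support_iff.2 hm)

/-- The generators do not involve `X i`, so a factor `X i` never affects divisibility by them. This
is the cancellation hypothesis of `length_quotient_sup_span_pow`. -/
theorem mem_monomialIdeal_of_X_mul_mem {S : Set (σ →₀ ℕ)} {i : σ} (hS : ∀ s ∈ S, s i = 0)
    (f : MvPolynomial σ k) (hf : X i * f ∈ monomialIdeal k S) : f ∈ monomialIdeal k S := by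
  classical
  rw [X, monomial_mul_mem_monomialIdeal] at hf
  rw [mem_ideal_span_monomial_image]
  intro m hm
  obtain ⟨s, hs, hsm⟩ := hf m hm
  refine ⟨s, hs, fun j => ?_⟩
  by_cases hj : j = i
  · subst hj
    simp [hS s hs]
  · simpa [Finsupp.single_apply, Ne.symm hj] using hsm j

theorem isHomogeneous_monomialIdeal (S : Set (σ →₀ ℕ)) :
    (monomialIdeal k S).IsHomogeneous (homogeneousSubmodule σ k) := by
  refine Ideal.homogeneous_span _ _ ?_
  rintro _ ⟨s, -, rfl⟩
  exact ⟨s.degree, isHomogeneous_monomial _ rfl⟩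

theorem irrelevant_eq_idealOfVars :
    (HomogeneousIdeal.irrelevant (homogeneousSubmodule σ k)).toIdeal = idealOfVars σ k := by
  ext f
  rw [HomogeneousIdeal.mem_iff, HomogeneousIdeal.mem_irrelevant_iff, ← pow_one (idealOfVars σ k),
    mem_pow_idealOfVars_iff', GradedRing.proj_apply]
  simp only [Nat.lt_one_iff, Finsupp.degree_eq_zero_iff, forall_eq]
  change ((decomposition.decompose' f 0 : homogeneousSubmodule σ k 0) : MvPolynomial σ k) = 0 ↔ _
  rw [decomposition.decompose'_apply, homogeneousComponent_zero, C_eq_zero]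

theorem monomial_single_mem_irrelevant_pow (i : σ) (t : ℕ) :
    monomial (Finsupp.single i t) (1 : k) ∈
      (HomogeneousIdeal.irrelevant (homogeneousSubmodule σ k)).toIdeal ^ t := by
  rw [irrelevant_eq_idealOfVars, monomial_mem_pow_idealOfVars_iff _ _ one_ne_zero]
  simp

/-- Testing annihilation only on pure powers of the variables already gives a condition strong
enough to determine the saturations below. -/
theorem exists_forall_le_of_mk_mem_sectionModule {S : Set (σ →₀ ℕ)} {f : MvPolynomial σ k}
    (hf : Submodule.Quotient.mk f ∈
      sectionModule (HomogeneousIdeal.irrelevant (homogeneousSubmodule σ k)).toIdeal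
        (MvPolynomial σ k ⧸ monomialIdeal k S)) :
    ∃ t : ℕ, ∀ i, ∀ m ∈ f.support, ∃ s ∈ S, s ≤ Finsupp.single i t + m := by
  obtain ⟨t, ht⟩ := hf
  refine ⟨t, fun i => monomial_mul_mem_monomialIdeal.1 ?_⟩
  exact (Submodule.Quotient.mk_eq_zero _).1 (ht _ (monomial_single_mem_irrelevant_pow i t))

theorem mk_monomial_mem_sectionModule {S : Set (σ →₀ ℕ)} {w : σ →₀ ℕ} (t : ℕ)
    (h : ∀ u : σ →₀ ℕ, t ≤ u.degree → ∃ s ∈ S, s ≤ w + u) :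
    Submodule.Quotient.mk (monomial w 1) ∈
      sectionModule (HomogeneousIdeal.irrelevant (homogeneousSubmodule σ k)).toIdeal
        (MvPolynomial σ k ⧸ monomialIdeal k S) := by
  refine ⟨t, fun a ha => (Submodule.Quotient.mk_eq_zero _).2 ?_⟩
  rw [irrelevant_eq_idealOfVars, mem_pow_idealOfVars_iff] at ha
  change a * monomial w 1 ∈ _
  rw [mul_comm, monomial_mul_mem_monomialIdeal]
  exact fun u hu => h u (ha u hu)

theorem length_sectionModule_eq_zero {S : Set (σ →₀ ℕ)}
    (h : ∀ (t : ℕ) (m : σ →₀ ℕ), (∀ i, ∃ s ∈ S, s ≤ Finsupp.single i t + m) → ∃ s ∈ S, s ≤ m) :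
    Module.length (MvPolynomial σ k)
      (sectionModule (HomogeneousIdeal.irrelevant (homogeneousSubmodule σ k)).toIdeal
        (MvPolynomial σ k ⧸ monomialIdeal k S)) = 0 := by
  rw [Module.length_eq_zero_iff, Submodule.subsingleton_iff_eq_bot, Submodule.eq_bot_iff]
  intro x hx
  obtain ⟨f, rfl⟩ := Submodule.Quotient.mk_surjective _ x
  obtain ⟨t, ht⟩ := exists_forall_le_of_mk_mem_sectionModule hx
  rw [Submodule.Quotient.mk_eq_zero, mem_ideal_span_monomial_image]
  exact fun m hm => h t m fun i => ht i m hm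

/-- If the saturation of a monomial ideal is generated by one further monomial, then the section
module of the quotient is cyclic, presented by the colon ideal of that monomial. -/
theorem length_sectionModule_eq_length_quotient {S T : Set (σ →₀ ℕ)} {w : σ →₀ ℕ} (d : ℕ)
    (hd : ∀ u : σ →₀ ℕ, d ≤ u.degree → ∃ s ∈ S, s ≤ w + u)
    (hsat : ∀ (t : ℕ) (m : σ →₀ ℕ), (∀ i, ∃ s ∈ S, s ≤ Finsupp.single i t + m) →
      (∃ s ∈ S, s ≤ m) ∨ w ≤ m)
    (hcolon : ∀ m : σ →₀ ℕ, (∃ s ∈ S, s ≤ w + m) ↔ ∃ s ∈ T, s ≤ m) :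
    Module.length (MvPolynomial σ k)
      (sectionModule (HomogeneousIdeal.irrelevant (homogeneousSubmodule σ k)).toIdeal
        (MvPolynomial σ k ⧸ monomialIdeal k S)) =
      Module.length (MvPolynomial σ k) (MvPolynomial σ k ⧸ monomialIdeal k T) := by
  let φ : MvPolynomial σ k →ₗ[MvPolynomial σ k] (MvPolynomial σ k ⧸ monomialIdeal k S) :=
    LinearMap.toSpanSingleton _ _ (Submodule.Quotient.mk (monomial w 1))
  have hφ : ∀ r, φ r = Submodule.Quotient.mk (monomial w 1 * r) := fun r => by
    rw [mul_comm]; rfl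
  have hker : LinearMap.ker φ = monomialIdeal k T := by
    ext r
    rw [LinearMap.mem_ker, hφ, Submodule.Quotient.mk_eq_zero, monomial_mul_mem_monomialIdeal,
      mem_ideal_span_monomial_image]
    exact forall₂_congr fun m _ => hcolon m
  have hrange : LinearMap.range φ =
      sectionModule (HomogeneousIdeal.irrelevant (homogeneousSubmodule σ k)).toIdeal
        (MvPolynomial σ k ⧸ monomialIdeal k S) := by
    apply le_antisymm
    · rintro _ ⟨r, rfl⟩
      exact Submodule.smul_mem _ r (mk_monomial_mem_sectionModule d hd)
    · intro x hx
      obtain ⟨f, rfl⟩ := Submodule.Quotient.mk_surjective _ x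
      obtain ⟨t, ht⟩ := exists_forall_le_of_mk_mem_sectionModule hx
      have hf : f ∈ monomialIdeal k S ⊔ Ideal.span {monomial w 1} := by
        rw [show Ideal.span {monomial w (1 : k)} = monomialIdeal k {w} by simp [monomialIdeal],
          monomialIdeal_sup, mem_ideal_span_monomial_image]
        intro m hm
        rcases hsat t m fun i => ht i m hm with ⟨s, hs, hsm⟩ | hw
        · exact ⟨s, Or.inl hs, hsm⟩
        · exact ⟨w, Or.inr rfl, hw⟩
      obtain ⟨j, hj, z, hz, rfl⟩ := Submodule.mem_sup.1 hf
      obtain ⟨r, rfl⟩ := Ideal.mem_span_singleton.1 hz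
      refine ⟨r, ?_⟩
      rw [hφ, Submodule.Quotient.eq]
      simpa using hj
  rw [← hrange, ← hker]
  exact (φ.quotKerEquivRange.length_eq).symm

-- Each variable is a nonzerodivisor modulo pure powers of the others, so the exponents drop from
-- `q` to `1` one at a time, each contributing a factor `q`; the residue field remains.
variable (k) in
theorem length_quotient_X_pow (q : ℕ) :
    Module.length (MvPolynomial (Fin 3) k)
      (MvPolynomial (Fin 3) k ⧸ monomialIdeal k (Set.range fun i : Fin 3 => Finsupp.single i q)) =
      (q : ℕ∞) ^ 3 := by
  let e : Fin 3 → ℕ → Set (Fin 3 →₀ ℕ) := fun i n => {Finsupp.single i n}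
  have step : ∀ (S : Set (Fin 3 →₀ ℕ)) (i : Fin 3), (∀ s ∈ S, s i = 0) →
      Module.length (MvPolynomial (Fin 3) k)
        (MvPolynomial (Fin 3) k ⧸ monomialIdeal k (S ∪ e i q)) =
      q * Module.length (MvPolynomial (Fin 3) k)
        (MvPolynomial (Fin 3) k ⧸ monomialIdeal k (S ∪ e i 1)) := by
    intro S i hS
    have := length_quotient_sup_span_pow (monomialIdeal k S) (X i)
      (mem_monomialIdeal_of_X_mul_mem hS) q
    rwa [← pow_one (X i : MvPolynomial (Fin 3) k), ← pow_mul, one_mul, span_singleton_X_pow,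
      span_singleton_X_pow, monomialIdeal_sup, monomialIdeal_sup] at this
  have hvars : monomialIdeal k (e 1 1 ∪ e 0 1 ∪ e 2 1) = RingHom.ker (constantCoeff (R := k)) := by
    ext f
    rw [mem_ideal_span_monomial_image, RingHom.mem_ker, constantCoeff_eq]
    have hne : ∀ m : Fin 3 →₀ ℕ, (∃ s ∈ e 1 1 ∪ e 0 1 ∪ e 2 1, s ≤ m) ↔ m ≠ 0 := by
      intro m
      have h0 : m = 0 ↔ m 0 = 0 ∧ m 1 = 0 ∧ m 2 = 0 := by
        simp [DFunLike.ext_iff, Fin.forall_fin_succ]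
      simp only [e, Set.mem_union, Set.mem_singleton_iff, or_and_right, exists_or, exists_eq_left,
        Finsupp.single_le_iff, ne_eq, h0]
      omega
    simp_rw [hne]
    rw [← notMem_support_iff]
    exact ⟨fun h h0 => h 0 h0 rfl, fun h m hm h0 => h (h0 ▸ hm)⟩
  have hone : Module.length (MvPolynomial (Fin 3) k)
      (MvPolynomial (Fin 3) k ⧸ monomialIdeal k (e 1 1 ∪ e 0 1 ∪ e 2 1)) = 1 := by
    rw [hvars, Module.length_eq_one_iff, isSimpleModule_iff_isCoatom, ← Ideal.isMaximal_def]
    exact RingHom.ker_isMaximal_of_surjective _ fun x => ⟨C x, constantCoeff_C _ x⟩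
  have hrange : (Set.range fun i : Fin 3 => Finsupp.single i q) = e 1 q ∪ e 2 q ∪ e 0 q := by
    ext s
    simp [e, Fin.exists_fin_succ, eq_comm]
    tauto
  rw [hrange, step _ 0 (by simp [e]), show e 1 q ∪ e 2 q ∪ e 0 1 = e 0 1 ∪ e 2 q ∪ e 1 q by
    ext; simp; tauto, step _ 1 (by simp [e]), show e 0 1 ∪ e 2 q ∪ e 1 1 = e 1 1 ∪ e 0 1 ∪ e 2 q by
    ext; simp; tauto, step _ 2 (by simp [e]), hone]
  ring

end Monomial

/-! ### The multiplicities of the examples -/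

section Multiplicity

open MvPolynomial Pointwise

/-- In every example the normalized sequence is constant, so no asymptotics are needed. -/
theorem gHKMultiplicity_eq_of_forall_eq {k R : Type*} [Field k] [CommRing R] [Algebra k R]
    (𝒜 : ℕ → Submodule k R) [GradedAlgebra 𝒜] (p : ℕ) (I : Ideal R) (e : ℝ≥0∞)
    (h : ∀ n, (gHKFunction 𝒜 p I n : ℝ≥0∞) / (p : ℝ≥0∞) ^ (n * krullDimNat R) = e) :
    gHKMultiplicity 𝒜 p I = e := by
  have ht : Tendsto (fun n : ℕ => (gHKFunction 𝒜 p I n : ℝ≥0∞) /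
      (p : ℝ≥0∞) ^ (n * krullDimNat R)) atTop (𝓝 e) := by
    simp_rw [h]
    exact tendsto_const_nhds
  have hex : ∃ e : ℝ≥0∞, Tendsto (fun n : ℕ => (gHKFunction 𝒜 p I n : ℝ≥0∞) /
      (p : ℝ≥0∞) ^ (n * krullDimNat R)) atTop (𝓝 e) := ⟨e, ht⟩
  rw [gHKMultiplicity, dif_pos hex]
  exact tendsto_nhds_unique hex.choose_spec ht

theorem krullDimNat_mvPolynomial (k : Type*) [Field k] (n : ℕ) :
    krullDimNat (MvPolynomial (Fin n) k) = n := by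
  rw [krullDimNat, MvPolynomial.ringKrullDim_of_isNoetherianRing, ringKrullDim_eq_zero_of_field]
  simp

variable (k : Type*) [Field k] (p : ℕ) [Fact p.Prime] [CharP k p]

/-- The exponents of the monomials `XY`, `YZ`, `XZ`, which generate the ideal of the three
coordinate points of the projective plane. -/
noncomputable def pairExponents : Set (Fin 3 →₀ ℕ) :=
  {Finsupp.single 0 1 + Finsupp.single 1 1, Finsupp.single 1 1 + Finsupp.single 2 1,
    Finsupp.single 0 1 + Finsupp.single 2 1}

theorem exists_mem_smul_pairExponents_le (q : ℕ) (m : Fin 3 →₀ ℕ) :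
    (∃ s ∈ (fun s => q • s) '' pairExponents, s ≤ m) ↔
      (q ≤ m 0 ∧ q ≤ m 1) ∨ (q ≤ m 1 ∧ q ≤ m 2) ∨ (q ≤ m 0 ∧ q ≤ m 2) := by
  rw [Set.exists_mem_image]
  simp [pairExponents, Finsupp.le_def, Fin.forall_fin_succ]

theorem exists_mem_smul_pairExponents_add_le (q : ℕ) (m : Fin 3 →₀ ℕ) :
    (∃ s ∈ (fun s => q • s) '' (pairExponents + pairExponents), s ≤ m) ↔
      (2 * q ≤ m 0 ∧ 2 * q ≤ m 1) ∨ (2 * q ≤ m 1 ∧ 2 * q ≤ m 2) ∨ (2 * q ≤ m 0 ∧ 2 * q ≤ m 2) ∨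
      (q ≤ m 0 ∧ q ≤ m 1 ∧ q ≤ m 2 ∧ (2 * q ≤ m 0 ∨ 2 * q ≤ m 1 ∨ 2 * q ≤ m 2)) := by
  simp only [Set.exists_mem_image, ← Set.image2_add, Set.exists_mem_image2, pairExponents,
    Set.mem_insert_iff, Set.mem_singleton_iff, exists_eq_or_imp, exists_eq_left]
  simp [Finsupp.le_def, Fin.forall_fin_succ]
  omega

theorem gHKMultiplicity_pairs :
    gHKMultiplicity (homogeneousSubmodule (Fin 3) k) p (monomialIdeal k pairExponents) = 0 := by
  refine gHKMultiplicity_eq_of_forall_eq _ _ _ _ fun n => ?_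
  rw [gHKFunction, frobeniusPower_monomialIdeal, length_sectionModule_eq_zero]
  · simp
  -- Membership needs two exponents `≥ q`. If at most one is, raising that same coordinate does not
  -- help.
  · intro t m h
    simp only [exists_mem_smul_pairExponents_le, Fin.forall_fin_succ] at h ⊢
    simp [Finsupp.single_apply] at h
    omega

theorem gHKMultiplicity_pairs_mul_pairs :
    gHKMultiplicity (homogeneousSubmodule (Fin 3) k) p
      (monomialIdeal k pairExponents * monomialIdeal k pairExponents) = 1 := by
  refine gHKMultiplicity_eq_of_forall_eq _ _ _ _ fun n => ?_
  have hlen : gHKFunction (homogeneousSubmodule (Fin 3) k) p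
      (monomialIdeal k pairExponents * monomialIdeal k pairExponents) n = (p ^ n : ℕ) ^ 3 := by
    rw [gHKFunction, monomialIdeal_mul, frobeniusPower_monomialIdeal, ← length_quotient_X_pow k]
    generalize p ^ n = q
    refine length_sectionModule_eq_length_quotient
      (w := Finsupp.equivFunOnFinite.symm fun _ => q) (3 * q) ?_ ?_ ?_
    -- Degree at least `3 * q` forces some `u i ≥ q`, so `w + u` has all exponents `≥ q` and one `≥
    -- 2 * q`.
    · intro u hu
      rw [exists_mem_smul_pairExponents_add_le]
      simp [Finsupp.degree_eq_sum, Fin.sum_univ_three] at hu ⊢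
      omega
    -- If, say, `m 0 < q`, raising coordinate `1` forces `m 2 ≥ 2 * q` and raising coordinate `2`
    -- forces `m 1 ≥ 2 * q`, so `m` is already in the ideal.
    · intro t m h
      simp only [exists_mem_smul_pairExponents_add_le, Fin.forall_fin_succ] at h ⊢
      simp [Finsupp.single_apply, Finsupp.le_def, Fin.forall_fin_succ] at h ⊢
      omega
    · intro m
      rw [exists_mem_smul_pairExponents_add_le]
      simp [Fin.exists_fin_succ]
      omega
  have hp : (p : ℝ≥0∞) ≠ 0 := by exact_mod_cast (Fact.out : p.Prime).ne_zero
  rw [hlen, krullDimNat_mvPolynomial]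
  simp only [ENat.toENNReal_pow, ENat.toENNReal_coe, Nat.cast_pow, ← pow_mul]
  exact ENNReal.div_self (pow_ne_zero _ hp) (ENNReal.pow_ne_top (ENNReal.natCast_ne_top p))

theorem gHKMultiplicity_span_X_pow (i : Fin 3) (d : ℕ) :
    gHKMultiplicity (homogeneousSubmodule (Fin 3) k) p
      (monomialIdeal k {Finsupp.single i d}) = 0 := by
  refine gHKMultiplicity_eq_of_forall_eq _ _ _ _ fun n => ?_
  rw [gHKFunction, frobeniusPower_monomialIdeal, length_sectionModule_eq_zero]
  · simp
  · intro t m h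
    -- Multiplying by a power of a different variable leaves the exponent of `X i` unchanged.
    obtain ⟨s, hs, hsm⟩ := h (i + 1)
    refine ⟨s, hs, fun j => ?_⟩
    obtain ⟨_, rfl, rfl⟩ := hs
    rcases eq_or_ne j i with rfl | hj
    · simpa using hsm j
    · simp [hj.symm]

end Multiplicity

theorem mainTheorem10 (p : ℕ) (hp : p.Prime) (k : Type*) [Field k] [CharP k p]
    (F : MvPolynomial (Fin 2) ℝ) :
    ∃ I J : Ideal (MvPolynomial (Fin 3) k),
      I.IsHomogeneous (MvPolynomial.homogeneousSubmodule (Fin 3) k) ∧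
      J.IsHomogeneous (MvPolynomial.homogeneousSubmodule (Fin 3) k) ∧
      (∀ c : ClosureOperator (Ideal (MvPolynomial (Fin 3) k)), ProjectivelySameClosure c I J) ∧
      ∃ e₁ e₂ e₃ : ℝ≥0,
        gHKMultiplicity (MvPolynomial.homogeneousSubmodule (Fin 3) k) p I = (e₁ : ℝ≥0∞) ∧
        gHKMultiplicity (MvPolynomial.homogeneousSubmodule (Fin 3) k) p J = (e₂ : ℝ≥0∞) ∧
        gHKMultiplicity (MvPolynomial.homogeneousSubmodule (Fin 3) k) p (I * J) = (e₃ : ℝ≥0∞) ∧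
        MvPolynomial.eval ![(e₁ : ℝ), (e₂ : ℝ)] F ≠ (e₃ : ℝ) := by
  have : Fact p.Prime := ⟨hp⟩
  by_cases hF : MvPolynomial.eval ![(0 : ℝ), 0] F = 0
  · refine ⟨monomialIdeal k pairExponents, monomialIdeal k pairExponents,
      isHomogeneous_monomialIdeal _, isHomogeneous_monomialIdeal _,
      fun c => ⟨1, 1, one_pos, one_pos, rfl⟩, 0, 0, 1, ?_, ?_, ?_, ?_⟩
    · simpa using gHKMultiplicity_pairs k p
    · simpa using gHKMultiplicity_pairs k p
    · simpa using gHKMultiplicity_pairs_mul_pairs k p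
    · simp [hF]
  · refine ⟨monomialIdeal k {Finsupp.single 0 1}, monomialIdeal k {Finsupp.single 0 2},
      isHomogeneous_monomialIdeal _, isHomogeneous_monomialIdeal _,
      fun c => ⟨2, 1, two_pos, one_pos, ?_⟩, 0, 0, 0, ?_, ?_, ?_, ?_⟩
    · rw [sq, monomialIdeal_mul, Set.singleton_add_singleton, ← Finsupp.single_add, pow_one]
    · simpa using gHKMultiplicity_span_X_pow k p 0 1
    · simpa using gHKMultiplicity_span_X_pow k p 0 2
    · rw [monomialIdeal_mul, Set.singleton_add_singleton, ← Finsupp.single_add]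
      simpa using gHKMultiplicity_span_X_pow k p 0 3
    · simpa using hF
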